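/- Let $K$ be a commutative field of any characteristic. Let $\mathcal{H}$ be the free associative unital $K$-algebra generated by the set of planar rooted trees; its monomials, the planar forests (including the empty forest $1$), form a basis $\mathbf{F}$ of $\mathcal{H}$, and $\mathbf{F}(n)$ denotes the set of planar forests with $n$ vertices. Let $\bullet$ be the tree with one vertex, let $B^+:\mathcal{H}\to\mathcal{H}$ be the linear map that grafts the trees of a forest on a common root, let $\varepsilon(F)=\delta_{F,1}$ for $F\in\mathbf{F}$, and let $\gamma:\mathcal{H}\to\mathcal{H}$ be the linear map with $\gamma(1)=0$ and $\gamma(t_1\cdots t_k)=\delta_{t_1,\bullet}\,t_2\cdots t_k$ for trees $t_1,\dots,t_k$, $k\ge 1$. Let $\Delta:\mathcal{H}\to\mathcal{H}\otimes\mathcal{H}$ be the linear map determined by $$\Delta(1)=1\otimes 1,\quad \Delta(xy)=(x\otimes 1)\Delta(y)+\Delta(x)(1\otimes y)-x\otimes y,\quad \Delta(B^+(x))=(\mathrm{Id}\otimes B^+)\Delta(x)+B^+(x)\otimes 1,$$ and let $\langle-,-\rangle$ be the bilinear form on $\mathcal{H}$ determined by $$\langle 1,x\rangle=\varepsilon(x),\qquad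 \langle xy,z\rangle=\langle y\otimes x,\Delta(z)\rangle,\qquad \langle B^+(x),y\rangle=\langle x,\gamma(y)\rangle .$$ For $F,G\in\mathbf{F}$ write $F\le G$ if $G$ is obtained from $F$ by a finite (possibly empty) sequence of admissible transformations, where an admissible transformation takes a vertex $s$ that is the leftmost child of a vertex $v$, deletes the edge between them, and makes $s$, with everything above it, the sibling immediately to the left of $v$ (a child of the parent of $v$, or a root if $v$ is a root). This makes each $\mathbf{F}(n)$ a finite poset. Let $\mu:\mathbf{F}(n)^2\to K$ be its Möbius function: $\mu(F,G)=0$ if $F\nleq G$, and $\sum_{F\le G\le H}\mu(F,G)=\delta_{F,H}$ if $F\le H$. Let $m:\mathbf{F}\to\mathbf{F}$ be the weight-preserving map defined by $m(1)=1$ and $m(B^+(F_1)F_2)=B^+(m(F_2))\,m(F_1)$. Then for every $F\in\mathbf{F}$ there is a unique $f_F\in\mathcal{H}$ such that $\langle f_F,G\rangle=\delta_{F,G}$ for all $G\in\mathbf{F}$, the family $(f_F)_{F\in\mathbf{F}}$ is a basis of $\mathcal{H}$ (the dual basis of the basis of forests), and for all $n\ge 0$ and $F\in\mathbf{F}(n)$,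 $$f_F=\sum_{\substack{G\in\mathbf{F}(n)\\ G\le m(F)}}\mu(G,m(F))\,G .$$ -/

import Mathlib

open scoped TensorProduct

/-- Planar rooted trees: a tree is its root together with the ordered list (from left to right)
of the subtrees grafted on the root. `node []` is the tree with one vertex. -/
inductive PlanarTree : Type
  | node : List PlanarTree → PlanarTree

/-- Planar forests: finite words in planar rooted trees. The empty forest is `[]`, the product of
forests is concatenation, and `.node F :: G` is the forest `B⁺(F) G`. -/
abbrev PlanarForest : Type := List PlanarTree

namespace PlanarForest

/-- The weight of a forest: its number of vertices. -/
def weight : PlanarForest → ℕ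
  | [] => 0
  | .node F :: G => weight F + 1 + weight G

/-- The map `m`: `m(1) = 1` and `m(B⁺(F) G) = B⁺(m(G)) m(F)`. -/
def mirror : PlanarForest → PlanarForest
  | [] => []
  | .node F :: G => .node (mirror G) :: mirror F

theorem weight_append (F G : PlanarForest) : weight (F ++ G) = weight F + weight G := by
  induction F with
  | nil => simp [weight]
  | cons t F ih =>
    cases t with
    | node C => simp only [List.cons_append, weight, ih]; omega

theorem weight_mirror : ∀ F : PlanarForest, weight (mirror F) = weight F
  | [] => by simp [mirror]
  | .node F :: G => by
    have h1 := weight_mirror F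
    have h2 := weight_mirror G
    simp only [mirror, weight]
    omega

/-! ### The partial order on planar forests -/

/-- `Transforms F F'`: the forest `F'` is obtained from `F` by one admissible transformation.
Such a transformation holds on a vertex `s` that is the leftmost child of some vertex `v`: the edge
between `v` and `s` is removed and `s`, with everything above it, becomes the sibling immediately
to the left of `v`.
* `here`: `v` is a root of the forest under consideration, with `v = B⁺(B⁺(S) C)`, and
  `A B⁺(B⁺(S) C) D` becomes `A B⁺(S) B⁺(C) D`;
* `above`: the transformation takes place in the forest of the descendants of a root.

The transformations of the second kind are those in which `v` is a root of the whole forest (`here`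
alone); those of the first kind, in which `v` is a child of another vertex, are obtained by applying
`above` at least once. -/
inductive Transforms : PlanarForest → PlanarForest → Prop
  | here (A S C D : PlanarForest) :
      Transforms (A ++ .node (.node S :: C) :: D) (A ++ .node S :: .node C :: D)
  | above (A D : PlanarForest) {C C' : PlanarForest} (h : Transforms C C') :
      Transforms (A ++ .node C :: D) (A ++ .node C' :: D)

/-- `Below F G` (that is, `F ≤ G`): `G` is obtained from `F` by a finite, possibly empty, sequence
of admissible transformations. -/
def Below : PlanarForest → PlanarForest → Prop := Relation.ReflTransGen Transforms

/-- The sum over all vertices of the number of vertices of the path from the root; it is only used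
to see that the order is antisymmetric. -/
def heightSum : PlanarForest → ℕ
  | [] => 0
  | .node F :: G => heightSum F + weight F + 1 + heightSum G

theorem heightSum_append (F G : PlanarForest) :
    heightSum (F ++ G) = heightSum F + heightSum G := by
  induction F with
  | nil => simp [heightSum]
  | cons t F ih =>
    cases t with
    | node C => simp only [List.cons_append, heightSum, ih]; omega

theorem Transforms.weight_eq {F G : PlanarForest} (h : Transforms F G) : weight G = weight F := by
  induction h with
  | here A S C D => simp only [weight_append, weight]; omega
  | above A D _ ih => simp only [weight_append, weight, ih]

theorem Transforms.heightSum_lt {F G : PlanarForest} (h : Transforms F G) :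
    heightSum G < heightSum F := by
  induction h with
  | here A S C D => simp only [heightSum_append, heightSum, weight]; omega
  | above A D h ih =>
    simp only [heightSum_append, heightSum, h.weight_eq]; omega

theorem Below.heightSum_le {F G : PlanarForest} (h : Below F G) : heightSum G ≤ heightSum F := by
  induction h with
  | refl => exact le_rfl
  | tail _ h ih => exact h.heightSum_lt.le.trans ih

theorem Below.antisymm {F G : PlanarForest} (h : Below F G) (h' : Below G F) : F = G := by
  rcases Relation.ReflTransGen.cases_tail h with h1 | ⟨H, h1, h2⟩
  · exact h1.symm
  · have e1 := Below.heightSum_le h1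
    have e2 := h2.heightSum_lt
    have e3 := h'.heightSum_le
    omega

theorem finite_weight_le (n : ℕ) : {F : PlanarForest | weight F ≤ n}.Finite := by
  induction n with
  | zero =>
    refine (Set.finite_singleton ([] : PlanarForest)).subset ?_
    intro F hF
    match F with
    | [] => rfl
    | .node C :: G => simp [weight] at hF
  | succ n ih =>
    refine ((Set.finite_singleton ([] : PlanarForest)).union
      (ih.image2 (fun F G => PlanarTree.node F :: G) ih)).subset ?_
    intro F hF
    match F with
    | [] => exact Or.inl rfl
    | .node C :: G =>
      simp only [Set.mem_ofPred_eq, weight] at hF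
      exact Or.inr ⟨C, by simp only [Set.mem_ofPred_eq]; omega, G,
        by simp only [Set.mem_ofPred_eq]; omega, rfl⟩

/-- The set `F(n)` of planar forests with `n` vertices. -/
def OfWeight (n : ℕ) : Type := {F : PlanarForest // weight F = n}

namespace OfWeight

/-- The underlying forest of an element of `F(n)`. -/
def forest {n : ℕ} (F : OfWeight n) : PlanarForest := F.1

/-- The involution of `F(n)` induced by `m`. -/
def mirror {n : ℕ} (F : OfWeight n) : OfWeight n :=
  ⟨PlanarForest.mirror F.1, (weight_mirror F.1).trans F.2⟩

/-- The poset `F(n)`. -/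
instance (n : ℕ) : PartialOrder (OfWeight n) where
  le F G := Below F.forest G.forest
  le_refl _ := Relation.ReflTransGen.refl
  le_trans _ _ _ h h' := Relation.ReflTransGen.trans h h'
  le_antisymm _ _ h h' := Subtype.ext (Below.antisymm h h')

instance (n : ℕ) : Finite (OfWeight n) :=
  ((finite_weight_le n).subset (fun _ h => le_of_eq h) :
    {F : PlanarForest | weight F = n}.Finite).to_subtype

noncomputable instance (n : ℕ) : Fintype (OfWeight n) := Fintype.ofFinite _

noncomputable instance (n : ℕ) : DecidableEq (OfWeight n) := Classical.decEq _

noncomputable instance (n : ℕ) : DecidableLE (OfWeight n) := Classical.decRel _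

noncomputable instance (n : ℕ) : DecidableLT (OfWeight n) := Classical.decRel _

noncomputable instance (n : ℕ) : LocallyFiniteOrder (OfWeight n) :=
  Fintype.toLocallyFiniteOrder

end OfWeight

end PlanarForest

noncomputable section

namespace PlanarForest

variable (K : Type*) [Field K]

/-! ### The infinitesimal Hopf algebra of planar forests -/

/-- The algebra `H`: the free associative unital `K`-algebra generated by the planar rooted
trees. -/
abbrev ForestAlgebra : Type _ := FreeAlgebra K PlanarTree

/-- The basis of `H` formed by the monomials, that is to say by the planar forests. -/
def forestBasis : Module.Basis PlanarForest K (ForestAlgebra K) :=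
  FreeAlgebra.basisFreeMonoid K PlanarTree

/-- The planar forest `F` seen as a monomial of `H`, the product of its trees in order. -/
def mon (F : PlanarForest) : ForestAlgebra K := (F.map (FreeAlgebra.ι K)).prod

theorem forestBasis_apply (F : PlanarForest) : forestBasis K F = mon K F := by
  have h : FreeAlgebra.basisFreeMonoid K PlanarTree (FreeMonoid.ofList F)
      = FreeMonoid.lift (FreeAlgebra.ι K) (FreeMonoid.ofList F) := by
    simp [FreeAlgebra.basisFreeMonoid, FreeAlgebra.equivMonoidAlgebraFreeMonoid]
  rw [FreeMonoid.lift_ofList] at h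
  exact h

/-- The operator `B⁺`, grafting the trees of a forest on a common root. -/
def graft : ForestAlgebra K →ₗ[K] ForestAlgebra K :=
  (forestBasis K).constr K fun F => mon K [.node F]

open Classical in
/-- The counit `ε(F) = δ_{F,1}`. -/
def counit : ForestAlgebra K →ₗ[K] K :=
  (forestBasis K).constr K fun F => if F = [] then 1 else 0

/-- The map `γ` on forests: `γ(t₁ t₂ ⋯ tₙ) = t₂ ⋯ tₙ` if `t₁` has only one vertex, and `0`
otherwise (in particular for the empty forest). -/
def gammaForest : PlanarForest → ForestAlgebra K
  | .node [] :: F => mon K F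
  | _ => 0

/-- The linear map `γ`. -/
def gamma : ForestAlgebra K →ₗ[K] ForestAlgebra K :=
  (forestBasis K).constr K (gammaForest K)

/-- The coproduct on the basis of forests, through
`Δ(1) = 1 ⊗ 1`, `Δ(xy) = (x ⊗ 1)Δ(y) + Δ(x)(1 ⊗ y) - x ⊗ y` and
`Δ(B⁺(x)) = (Id ⊗ B⁺)Δ(x) + B⁺(x) ⊗ 1`, applied to the forest `B⁺(F) G`. -/
def coproductForest : PlanarForest → ForestAlgebra K ⊗[K] ForestAlgebra K
  | [] => 1 ⊗ₜ 1
  | .node F :: G =>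
      (mon K [.node F] ⊗ₜ 1) * coproductForest G
        + ((graft K).lTensor (ForestAlgebra K) (coproductForest F) + mon K [.node F] ⊗ₜ 1)
          * (1 ⊗ₜ mon K G)
        - mon K [.node F] ⊗ₜ mon K G

/-- The infinitesimal coproduct `Δ`. -/
def coproduct : ForestAlgebra K →ₗ[K] ForestAlgebra K ⊗[K] ForestAlgebra K :=
  (forestBasis K).constr K (coproductForest K)

/-- The linear form `y ↦ ⟨F, y⟩` for a forest `F`, through `⟨1, y⟩ = ε(y)`,
`⟨xy, z⟩ = ⟨y ⊗ x, Δ(z)⟩` and `⟨B⁺(x), y⟩ = ⟨x, γ(y)⟩`, applied to the forest `B⁺(F) G`. -/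
def pairingForest : PlanarForest → (ForestAlgebra K →ₗ[K] K)
  | [] => counit K
  | .node F :: G =>
      LinearMap.mul' K K ∘ₗ TensorProduct.map (pairingForest G) (pairingForest F ∘ₗ gamma K)
        ∘ₗ coproduct K

/-- The pairing `⟨x, y⟩` on `H`, a bilinear form. -/
def pairing : ForestAlgebra K →ₗ[K] ForestAlgebra K →ₗ[K] K :=
  (forestBasis K).constr K (pairingForest K)

/-! ### The defining relations of the coproduct and of the pairing -/

variable {K}

theorem mon_nil : mon K [] = 1 := by simp [mon]

theorem mon_append (F G : PlanarForest) : mon K (F ++ G) = mon K F * mon K G := by simp [mon]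

theorem mon_cons (t : PlanarTree) (F : PlanarForest) : mon K (t :: F) = mon K [t] * mon K F := by
  simp [mon]

/-- Two linear maps on `H` that agree on forests are equal. -/
theorem hom_ext {M : Type*} [AddCommMonoid M] [Module K M] {f g : ForestAlgebra K →ₗ[K] M}
    (h : ∀ F, f (mon K F) = g (mon K F)) : f = g :=
  (forestBasis K).ext fun F => by rw [forestBasis_apply]; exact h F

theorem constr_mon {M : Type*} [AddCommMonoid M] [Module K M] (u : PlanarForest → M)
    (F : PlanarForest) : (forestBasis K).constr K u (mon K F) = u F := by
  rw [← forestBasis_apply, Module.Basis.constr_basis]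

theorem graft_mon (F : PlanarForest) : graft K (mon K F) = mon K [.node F] := constr_mon _ F

theorem counit_mon_nil : counit K (mon K []) = 1 := by simp [counit, constr_mon]

theorem counit_mon_cons (t : PlanarTree) (F : PlanarForest) : counit K (mon K (t :: F)) = 0 := by
  simp [counit, constr_mon]

theorem counit_one : counit K 1 = 1 := by rw [← mon_nil, counit_mon_nil]

/-- A property that is stable under linear combinations and holds for forests holds on `H`. -/
theorem forest_induction {P : ForestAlgebra K → Prop} (hm : ∀ F, P (mon K F))
    (ha : ∀ x y, P x → P y → P (x + y)) (hs : ∀ (a : K) x, P x → P (a • x))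
    (x : ForestAlgebra K) : P x := by
  have hx := (forestBasis K).mem_span x
  induction hx using Submodule.span_induction with
  | mem x h => obtain ⟨F, rfl⟩ := h; rw [forestBasis_apply]; exact hm F
  | zero => simpa using hs 0 _ (hm [])
  | add x y _ _ h h' => exact ha x y h h'
  | smul a x _ h => exact hs a x h

theorem counit_mul (x y : ForestAlgebra K) : counit K (x * y) = counit K x * counit K y := by
  induction x using forest_induction with
  | hm F =>
    cases F with
    | nil => simp [mon_nil, counit_one]
    | cons t F =>
      induction y using forest_induction with
      | hm G => rw [← mon_append, List.cons_append, counit_mon_cons, counit_mon_cons, zero_mul]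
      | ha y z h h' => simp only [mul_add, map_add, h, h']
      | hs a y h => simp only [mul_smul_comm, map_smul, h, smul_eq_mul]; ring
  | ha y z h h' => simp only [add_mul, map_add, h, h']
  | hs a y h => simp only [smul_mul_assoc, map_smul, h, smul_eq_mul]; ring

theorem gamma_mon (F : PlanarForest) : gamma K (mon K F) = gammaForest K F := constr_mon _ F

theorem coproduct_mon (F : PlanarForest) : coproduct K (mon K F) = coproductForest K F :=
  constr_mon _ F

theorem pairing_mon (F : PlanarForest) : pairing K (mon K F) = pairingForest K F :=
  constr_mon _ F

theorem coproduct_one : coproduct K 1 = 1 ⊗ₜ 1 := by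
  rw [← mon_nil, coproduct_mon, coproductForest, mon_nil]

theorem coproduct_graft (x : ForestAlgebra K) :
    coproduct K (graft K x)
      = (graft K).lTensor (ForestAlgebra K) (coproduct K x) + graft K x ⊗ₜ 1 := by
  suffices h : coproduct K ∘ₗ graft K = (graft K).lTensor (ForestAlgebra K) ∘ₗ coproduct K
      + (TensorProduct.mk K _ _).flip 1 ∘ₗ graft K from LinearMap.congr_fun h x
  refine hom_ext fun F => ?_
  simp [graft_mon, coproduct_mon, coproductForest, mon_nil, ← Algebra.TensorProduct.one_def]

theorem coproduct_mul (x y : ForestAlgebra K) :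
    coproduct K (x * y)
      = (x ⊗ₜ 1) * coproduct K y + coproduct K x * (1 ⊗ₜ y) - x ⊗ₜ y := by
  induction x using forest_induction with
  | hm F =>
    induction y using forest_induction with
    | hm G =>
      rw [← mon_append, coproduct_mon, coproduct_mon, coproduct_mon]
      induction F with
      | nil => simp [mon_nil, coproductForest, ← Algebra.TensorProduct.one_def]
      | cons t F ih =>
        cases t with
        | node C =>
          have e1 : mon K (.node C :: F) ⊗ₜ[K] (1 : ForestAlgebra K)
              = (mon K [.node C] ⊗ₜ 1) * (mon K F ⊗ₜ 1) := by
            rw [mon_cons]; simp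
          have e2 : (1 : ForestAlgebra K) ⊗ₜ[K] mon K (F ++ G)
              = (1 ⊗ₜ mon K F) * (1 ⊗ₜ mon K G) := by
            rw [mon_append]; simp
          have e3 : mon K [.node C] ⊗ₜ[K] mon K (F ++ G)
              = (mon K [.node C] ⊗ₜ mon K F) * (1 ⊗ₜ mon K G) := by
            rw [mon_append]; simp
          have e4 : mon K (.node C :: F) ⊗ₜ[K] mon K G
              = (mon K [.node C] ⊗ₜ 1) * (mon K F ⊗ₜ mon K G) := by
            rw [mon_cons]; simp
          rw [List.cons_append, coproductForest, coproductForest, ih, e1, e2, e3, e4]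
          simp only [mul_add, add_mul, mul_sub, sub_mul, mul_assoc]
          abel
    | ha y z h h' => simp only [mul_add, map_add, h, h', TensorProduct.tmul_add]; abel
    | hs a y h =>
      simp only [mul_smul_comm, map_smul, h, TensorProduct.tmul_smul, smul_add, smul_sub]
  | ha y z h h' => simp only [add_mul, map_add, h, h', TensorProduct.add_tmul]; abel
  | hs a y h =>
    simp only [smul_mul_assoc, map_smul, h, ← TensorProduct.smul_tmul', smul_add, smul_sub]

/-- A property that is stable under linear combinations, products and `B⁺` holds on `H`. -/
theorem algebra_induction {P : ForestAlgebra K → Prop} (h1 : P 1)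
    (hg : ∀ x, P x → P (graft K x)) (hm : ∀ x y, P x → P y → P (x * y))
    (ha : ∀ x y, P x → P y → P (x + y)) (hs : ∀ (a : K) x, P x → P (a • x))
    (x : ForestAlgebra K) : P x := by
  have h : ∀ n, ∀ F, weight F ≤ n → P (mon K F) := by
    intro n
    induction n with
    | zero =>
      intro F hF
      match F with
      | [] => rwa [mon_nil]
      | .node C :: G => simp [weight] at hF
    | succ n ih =>
      intro F hF
      match F with
      | [] => rwa [mon_nil]
      | .node C :: G =>
        simp only [weight] at hF
        rw [mon_cons, ← graft_mon]
        exact hm _ _ (hg _ (ih C (by omega))) (ih G (by omega))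
  exact forest_induction (fun F => h _ F le_rfl) ha hs x

theorem counit_graft (x : ForestAlgebra K) : counit K (graft K x) = 0 := by
  induction x using forest_induction with
  | hm F => rw [graft_mon, counit_mon_cons]
  | ha y z h h' => simp only [map_add, h, h', add_zero]
  | hs a y h => simp only [map_smul, h, smul_zero]

theorem counit_left (x : ForestAlgebra K) :
    (counit K).rTensor (ForestAlgebra K) (coproduct K x) = 1 ⊗ₜ x := by
  have hl : ∀ (a : ForestAlgebra K) (w : ForestAlgebra K ⊗[K] ForestAlgebra K),
      (counit K).rTensor (ForestAlgebra K) ((a ⊗ₜ 1) * w)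
        = counit K a • (counit K).rTensor (ForestAlgebra K) w := by
    intro a w
    induction w with
    | zero => simp
    | tmul b c => simp [counit_mul, TensorProduct.smul_tmul']
    | add u v hu hv => simp only [mul_add, map_add, hu, hv, smul_add]
  have hr : ∀ (a : ForestAlgebra K) (w : ForestAlgebra K ⊗[K] ForestAlgebra K),
      (counit K).rTensor (ForestAlgebra K) (w * (1 ⊗ₜ a))
        = (counit K).rTensor (ForestAlgebra K) w * (1 ⊗ₜ a) := by
    intro a w
    induction w with
    | zero => simp
    | tmul b c => simp
    | add u v hu hv => simp only [add_mul, map_add, hu, hv]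
  have hb : ∀ w : ForestAlgebra K ⊗[K] ForestAlgebra K,
      (counit K).rTensor (ForestAlgebra K) ((graft K).lTensor (ForestAlgebra K) w)
        = (graft K).lTensor K ((counit K).rTensor (ForestAlgebra K) w) := by
    intro w
    induction w with
    | zero => simp
    | tmul b c => simp
    | add u v hu hv => simp only [map_add, hu, hv]
  induction x using algebra_induction with
  | h1 => simp [coproduct_one, counit_one]
  | hg x h => rw [coproduct_graft, map_add, hb, h]; simp [counit_graft]
  | hm x y hx hy =>
    rw [coproduct_mul, map_sub, map_add, hl, hr, hx, hy]
    simp [TensorProduct.smul_tmul']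
  | ha x y hx hy => simp only [map_add, hx, hy, TensorProduct.tmul_add]
  | hs a x hx => simp only [map_smul, hx, TensorProduct.tmul_smul]

theorem counit_right (x : ForestAlgebra K) :
    (counit K).lTensor (ForestAlgebra K) (coproduct K x) = x ⊗ₜ 1 := by
  have hl : ∀ (a : ForestAlgebra K) (w : ForestAlgebra K ⊗[K] ForestAlgebra K),
      (counit K).lTensor (ForestAlgebra K) ((a ⊗ₜ 1) * w)
        = (a ⊗ₜ 1) * (counit K).lTensor (ForestAlgebra K) w := by
    intro a w
    induction w with
    | zero => simp
    | tmul b c => simp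
    | add u v hu hv => simp only [mul_add, map_add, hu, hv]
  have hr : ∀ (a : ForestAlgebra K) (w : ForestAlgebra K ⊗[K] ForestAlgebra K),
      (counit K).lTensor (ForestAlgebra K) (w * (1 ⊗ₜ a))
        = counit K a • (counit K).lTensor (ForestAlgebra K) w := by
    intro a w
    induction w with
    | zero => simp
    | tmul b c => simp [counit_mul, mul_comm, ← TensorProduct.tmul_smul]
    | add u v hu hv => simp only [add_mul, map_add, hu, hv, smul_add]
  have hb : ∀ w : ForestAlgebra K ⊗[K] ForestAlgebra K,
      (counit K).lTensor (ForestAlgebra K) ((graft K).lTensor (ForestAlgebra K) w) = 0 := by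
    intro w
    induction w with
    | zero => simp
    | tmul b c => simp [counit_graft]
    | add u v hu hv => simp only [map_add, hu, hv, add_zero]
  induction x using algebra_induction with
  | h1 => simp [coproduct_one, counit_one]
  | hg x h => rw [coproduct_graft, map_add, hb]; simp [counit_one]
  | hm x y hx hy =>
    rw [coproduct_mul, map_sub, map_add, hl, hr, hx, hy]
    simp [← TensorProduct.tmul_smul]
  | ha x y hx hy => simp only [map_add, hx, hy, TensorProduct.add_tmul]
  | hs a x hx => simp only [map_smul, hx, TensorProduct.smul_tmul']

/-- Coassociativity is compatible with the infinitesimal product rule. -/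
theorem coassoc_mul {A : Type*} [Ring A] [Algebra K A] (Δ : A →ₗ[K] A ⊗[K] A)
    (hΔ : ∀ x y, Δ (x * y) = (x ⊗ₜ 1) * Δ y + Δ x * (1 ⊗ₜ y) - x ⊗ₜ y) {x y : A}
    (hx : TensorProduct.assoc K A A A (Δ.rTensor A (Δ x)) = Δ.lTensor A (Δ x))
    (hy : TensorProduct.assoc K A A A (Δ.rTensor A (Δ y)) = Δ.lTensor A (Δ y)) :
    TensorProduct.assoc K A A A (Δ.rTensor A (Δ (x * y))) = Δ.lTensor A (Δ (x * y)) := by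
  -- `M u w` is `a ⊗ bc ⊗ d` for `u = a ⊗ b` and `w = c ⊗ d`
  let M : A ⊗[K] A → A ⊗[K] A →
      A ⊗[K] (A ⊗[K] A) :=
    fun u w => TensorProduct.assoc K _ _ _ (u ⊗ₜ 1) * (1 ⊗ₜ w)
  let T1 : A ⊗[K] A →ₗ[K]
      A ⊗[K] (A ⊗[K] A) :=
    (TensorProduct.assoc K _ _ _).toLinearMap ∘ₗ Δ.rTensor (A)
  let T2 : A ⊗[K] A →ₗ[K]
      A ⊗[K] (A ⊗[K] A) :=
    Δ.lTensor (A)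
  have t1 : ∀ a b, T1 (a ⊗ₜ b) = TensorProduct.assoc K _ _ _ (Δ a ⊗ₜ b) :=
    fun a b => by simp [T1]
  have t2 : ∀ a b, T2 (a ⊗ₜ b) = a ⊗ₜ Δ b := fun a b => by simp [T2]
  have M_add : ∀ u v w, M u (v + w) = M u v + M u w := by
    intro u v w; simp only [M, TensorProduct.tmul_add, mul_add]
  have add_M : ∀ u v w, M (u + v) w = M u w + M v w := by
    intro u v w; simp only [M, TensorProduct.add_tmul, map_add, add_mul]
  have assoc_l : ∀ (a d : A) (u : A ⊗[K] A),
      TensorProduct.assoc K _ _ _ (((a ⊗ₜ 1) * u) ⊗ₜ d)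
        = (a ⊗ₜ 1) * TensorProduct.assoc K _ _ _ (u ⊗ₜ[K] d) := by
    intro a d u
    induction u with
    | zero => simp
    | tmul p q => simp
    | add u v hu hv => simp only [mul_add, TensorProduct.add_tmul, map_add, hu, hv]
  have assoc_r : ∀ (c d : A) (u : A ⊗[K] A),
      TensorProduct.assoc K _ _ _ ((u * (1 ⊗ₜ c)) ⊗ₜ d) = M u (c ⊗ₜ[K] d) := by
    intro c d u
    induction u with
    | zero => simp [M]
    | tmul p q => simp [M]
    | add u v hu hv => simp only [add_mul, TensorProduct.add_tmul, map_add, hu, hv, add_M]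
  have l1 : ∀ x w, T1 ((x ⊗ₜ 1) * w)
      = (x ⊗ₜ 1) * T1 w + M (Δ x) w - x ⊗ₜ w := by
    intro x w
    induction w with
    | zero => simp [M]
    | tmul c d =>
      rw [Algebra.TensorProduct.tmul_mul_tmul, one_mul, t1, t1, hΔ,
        TensorProduct.sub_tmul, TensorProduct.add_tmul, map_sub, map_add, assoc_l x d,
        assoc_r, TensorProduct.assoc_tmul]
    | add u v hu hv =>
      simp only [mul_add, map_add, hu, hv, M_add, TensorProduct.tmul_add]; abel
  have r1 : ∀ y w, T1 (w * (1 ⊗ₜ y)) = T1 w * (1 ⊗ₜ (1 ⊗ₜ y)) := by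
    intro y w
    induction w with
    | zero => simp
    | tmul c d =>
      rw [Algebra.TensorProduct.tmul_mul_tmul, mul_one, t1, t1]
      induction Δ c with
      | zero => simp
      | tmul p q => simp
      | add u v hu hv => simp only [add_mul, TensorProduct.add_tmul, map_add, hu, hv]
    | add u v hu hv => simp only [add_mul, map_add, hu, hv]
  have l2 : ∀ x w, T2 ((x ⊗ₜ 1) * w) = (x ⊗ₜ 1) * T2 w := by
    intro x w
    induction w with
    | zero => simp
    | tmul c d =>
      rw [Algebra.TensorProduct.tmul_mul_tmul, one_mul, t2, t2,
        Algebra.TensorProduct.tmul_mul_tmul, one_mul]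
    | add u v hu hv => simp only [mul_add, map_add, hu, hv]
  have r2 : ∀ y w, T2 (w * (1 ⊗ₜ y)) = M w (Δ y) + T2 w * (1 ⊗ₜ (1 ⊗ₜ y))
      - TensorProduct.assoc K _ _ _ (w ⊗ₜ y) := by
    intro y w
    induction w with
    | zero => simp [M]
    | tmul c d =>
      rw [Algebra.TensorProduct.tmul_mul_tmul, mul_one, t2, t2, hΔ]
      simp [M, TensorProduct.tmul_add, TensorProduct.tmul_sub]
    | add u v hu hv =>
      simp only [add_mul, map_add, hu, hv, add_M, TensorProduct.add_tmul]; abel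
  change T1 (Δ x) = T2 (Δ x) at hx
  change T1 (Δ y) = T2 (Δ y) at hy
  change T1 (Δ (x * y)) = T2 (Δ (x * y))
  rw [hΔ, map_sub, map_add, map_sub, map_add, l1, r1, l2, r2, hx, hy, t1, t2]
  abel

theorem coproduct_coassoc (x : ForestAlgebra K) :
    TensorProduct.assoc K _ _ _ ((coproduct K).rTensor (ForestAlgebra K) (coproduct K x))
      = (coproduct K).lTensor (ForestAlgebra K) (coproduct K x) := by
  let T1 : ForestAlgebra K ⊗[K] ForestAlgebra K →ₗ[K]
      ForestAlgebra K ⊗[K] (ForestAlgebra K ⊗[K] ForestAlgebra K) :=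
    (TensorProduct.assoc K _ _ _).toLinearMap ∘ₗ (coproduct K).rTensor (ForestAlgebra K)
  let T2 : ForestAlgebra K ⊗[K] ForestAlgebra K →ₗ[K]
      ForestAlgebra K ⊗[K] (ForestAlgebra K ⊗[K] ForestAlgebra K) :=
    (coproduct K).lTensor (ForestAlgebra K)
  have t1 : ∀ a b, T1 (a ⊗ₜ b) = TensorProduct.assoc K _ _ _ (coproduct K a ⊗ₜ b) :=
    fun a b => by simp [T1]
  have t2 : ∀ a b, T2 (a ⊗ₜ b) = a ⊗ₜ coproduct K b := fun a b => by simp [T2]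
  have g1 : ∀ w, T1 ((graft K).lTensor (ForestAlgebra K) w)
      = ((graft K).lTensor (ForestAlgebra K)).lTensor (ForestAlgebra K) (T1 w) := by
    intro w
    induction w with
    | zero => simp
    | tmul c d =>
      rw [LinearMap.lTensor_tmul, t1, t1]
      induction coproduct K c with
      | zero => simp
      | tmul p q => simp
      | add u v hu hv => simp only [TensorProduct.add_tmul, map_add, hu, hv]
    | add u v hu hv => simp only [map_add, hu, hv]
  have g2 : ∀ w, T2 ((graft K).lTensor (ForestAlgebra K) w)
      = ((graft K).lTensor (ForestAlgebra K)).lTensor (ForestAlgebra K) (T2 w)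
        + TensorProduct.assoc K _ _ _ ((graft K).lTensor (ForestAlgebra K) w ⊗ₜ 1) := by
    intro w
    induction w with
    | zero => simp
    | tmul c d =>
      rw [LinearMap.lTensor_tmul, t2, t2, coproduct_graft]
      simp [TensorProduct.tmul_add]
    | add u v hu hv => simp only [map_add, hu, hv, TensorProduct.add_tmul]; abel
  induction x using algebra_induction with
  | hm x y hx hy => exact coassoc_mul (coproduct K) coproduct_mul hx hy
  | h1 =>
    change T1 (coproduct K 1) = T2 (coproduct K 1)
    rw [coproduct_one, t1, t2, coproduct_one]; simp
  | hg x h =>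
    change T1 (coproduct K x) = T2 (coproduct K x) at h
    change T1 (coproduct K (graft K x)) = T2 (coproduct K (graft K x))
    rw [coproduct_graft, map_add, map_add, g1, g2, h, t1, t2, coproduct_graft, coproduct_one]
    simp only [TensorProduct.add_tmul, map_add, TensorProduct.assoc_tmul]
    abel
  | ha x y hx hy => simp only [map_add, hx, hy]
  | hs a x hx => simp only [map_smul, hx]

theorem pairing_one (x : ForestAlgebra K) : pairing K 1 x = counit K x := by
  rw [← mon_nil, pairing_mon, pairingForest]

theorem pairing_graft (x y : ForestAlgebra K) :
    pairing K (graft K x) y = pairing K x (gamma K y) := by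
  suffices h : pairing K ∘ₗ graft K = (pairing K).compl₂ (gamma K) from
    LinearMap.congr_fun (LinearMap.congr_fun h x) y
  refine hom_ext fun F => LinearMap.ext fun z => ?_
  rw [LinearMap.comp_apply, graft_mon, pairing_mon, LinearMap.compl₂_apply, pairing_mon,
    pairingForest, pairingForest, ← LinearMap.lTensor_comp_rTensor]
  simp only [LinearMap.comp_apply, counit_left]
  simp

theorem pairing_mul (x y z : ForestAlgebra K) :
    pairing K (x * y) z
      = LinearMap.mul' K K (TensorProduct.map (pairing K y) (pairing K x) (coproduct K z)) := by
  induction x using forest_induction with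
  | hm F =>
    induction y using forest_induction with
    | hm G =>
      induction F generalizing z with
      | nil =>
        have h : ∀ w : ForestAlgebra K ⊗[K] ForestAlgebra K,
            LinearMap.mul' K K (TensorProduct.map (pairing K (mon K G)) (counit K) w)
              = LinearMap.mul' K K ((pairing K (mon K G)).rTensor K
                  ((counit K).lTensor (ForestAlgebra K) w)) := by
          intro w
          induction w with
          | zero => simp
          | tmul a b => simp
          | add u v hu hv => simp only [map_add, hu, hv]
        rw [mon_nil, one_mul, show pairing K 1 = counit K from LinearMap.ext pairing_one, h,
          counit_right]
        simp
      | cons t F ih =>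
        cases t with
        | node C =>
          have ih' : pairingForest K (F ++ G) = LinearMap.mul' K K ∘ₗ
              TensorProduct.map (pairing K (mon K G)) (pairing K (mon K F)) ∘ₗ coproduct K := by
            refine LinearMap.ext fun u => ?_
            rw [← pairing_mon, mon_append, ih u]
            rfl
          have h1 : ∀ w : ForestAlgebra K ⊗[K] ForestAlgebra K,
              LinearMap.mul' K K (TensorProduct.map (LinearMap.mul' K K ∘ₗ
                TensorProduct.map (pairing K (mon K G)) (pairing K (mon K F)) ∘ₗ coproduct K)
                  (pairingForest K C ∘ₗ gamma K) w)
              = LinearMap.mul' K K ((LinearMap.mul' K K).lTensor K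
                  (TensorProduct.map (pairing K (mon K G)) (TensorProduct.map
                    (pairing K (mon K F)) (pairingForest K C ∘ₗ gamma K))
                  (TensorProduct.assoc K _ _ _
                    ((coproduct K).rTensor (ForestAlgebra K) w)))) := by
            intro w
            induction w with
            | zero => simp
            | tmul a b =>
              simp only [TensorProduct.map_tmul, LinearMap.comp_apply, LinearMap.rTensor_tmul]
              induction coproduct K a with
              | zero => simp
              | tmul p q => simp [mul_assoc]
              | add u v hu hv =>
                simp only [TensorProduct.add_tmul, map_add, ← hu, ← hv]
            | add u v hu hv => simp only [map_add, hu, hv]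
          have h2 : ∀ w : ForestAlgebra K ⊗[K] ForestAlgebra K,
              LinearMap.mul' K K (TensorProduct.map (pairing K (mon K G)) (LinearMap.mul' K K ∘ₗ
                TensorProduct.map (pairing K (mon K F)) (pairingForest K C ∘ₗ gamma K)
                  ∘ₗ coproduct K) w)
              = LinearMap.mul' K K ((LinearMap.mul' K K).lTensor K
                  (TensorProduct.map (pairing K (mon K G)) (TensorProduct.map
                    (pairing K (mon K F)) (pairingForest K C ∘ₗ gamma K))
                    ((coproduct K).lTensor (ForestAlgebra K) w))) := by
            intro w
            induction w with
            | zero => simp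
            | tmul a b => simp
            | add u v hu hv => simp only [map_add, hu, hv]
          rw [← mon_append, List.cons_append, pairing_mon, pairing_mon (.node C :: F),
            pairingForest, pairingForest, ih', ← pairing_mon F, h2, ← coproduct_coassoc, ← h1]
          rfl
    | ha y y' h h' => simp only [mul_add, map_add, LinearMap.add_apply, h, h',
        TensorProduct.map_add_left]
    | hs a y h => simp only [mul_smul_comm, map_smul, LinearMap.smul_apply, h,
        TensorProduct.map_smul_left]
  | ha x x' h h' => simp only [add_mul, map_add, LinearMap.add_apply, h, h',
      TensorProduct.map_add_right]
  | hs a x h => simp only [smul_mul_assoc, map_smul, LinearMap.smul_apply, h,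
      TensorProduct.map_smul_right]

end PlanarForest

end

namespace PlanarForest

/-! ### The mirror map is an involution -/

/-! The heart is `pairing_mon_mon`: `⟨F, G⟩` is `1` if `m(G) ≤ F` and `0` otherwise. So, up to the
involution `m`, the Gram matrix of the forests is the zeta function of the order, and its inverse is
the Möbius function. Both sides obey the same recursion on `F = B⁺(C) D`, indexed by the
factorizations `G = A B⁺(H) L`. On the algebraic side, `γ` applied to the right factor of `Δ(G)`
leaves only the sum of the `A H ⊗ L` (`lTensor_gamma_coproduct_mon`), so `⟨B⁺(C) D, G⟩` is the sum
of the `⟨D, A H⟩ ⟨C, L⟩` (`pairing_mon_cons`). On the order side, a forest lies below `B⁺(C) D`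
exactly when some full subtree `B⁺(P)` on its leftmost branch has `P ≤ C` and a remainder `R ≤ D`
(`below_node_cons_iff`). For `m(G)` these pairs `(P, R)` are the `(m(L), m(A H))`
(`leftCut_mirror_iff`). Transformations preserve weight, and the weight of `L` determines the
factorization. Hence at most one term is nonzero and the sum is `0` or `1` in any characteristic. -/

theorem mirror_mirror : ∀ F : PlanarForest, mirror (mirror F) = F
  | [] => by simp [mirror]
  | .node F :: G => by simp only [mirror, mirror_mirror F, mirror_mirror G]

theorem eq_nil_of_weight_eq_zero {F : PlanarForest} (h : weight F = 0) : F = [] := by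
  match F with
  | [] => rfl
  | .node C :: G => simp [weight] at h

theorem Below.weight_eq {F G : PlanarForest} (h : Below F G) : weight G = weight F := by
  induction h with
  | refl => rfl
  | tail _ h ih => exact h.weight_eq.trans ih

theorem below_nil_iff {F : PlanarForest} : Below F [] ↔ F = [] := by
  constructor
  · intro h
    exact eq_nil_of_weight_eq_zero (h.weight_eq.symm.trans (by simp [weight]))
  · rintro rfl
    exact Relation.ReflTransGen.refl

theorem mirror_eq_nil_iff {F : PlanarForest} : mirror F = [] ↔ F = [] := by
  constructor
  · intro h
    rw [← mirror_mirror F, h, mirror]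
  · rintro rfl
    rw [mirror]

/-! ### Compatibility of the order with grafting and concatenation -/

theorem Transforms.cons (t : PlanarTree) {F G : PlanarForest} (h : Transforms F G) :
    Transforms (t :: F) (t :: G) := by
  cases h with
  | here A S C D => exact Transforms.here (t :: A) S C D
  | above A D h => exact Transforms.above (t :: A) D h

theorem Below.cons (t : PlanarTree) {F G : PlanarForest} (h : Below F G) :
    Below (t :: F) (t :: G) :=
  Relation.ReflTransGen.lift (t :: ·) (fun _ _ h => Transforms.cons t h) _ _ h

theorem Below.node {F G : PlanarForest} (h : Below F G) (D : PlanarForest) :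
    Below (.node F :: D) (.node G :: D) :=
  Relation.ReflTransGen.lift (fun C => PlanarTree.node C :: D)
    (fun _ _ h => Transforms.above [] D h) _ _ h

theorem Below.node_cons {F F' G G' : PlanarForest} (hF : Below F F') (hG : Below G G') :
    Below (.node F :: G) (.node F' :: G') :=
  Relation.ReflTransGen.trans (hF.node G) (hG.cons _)

/-! ### Cuts along the leftmost branch and the recursion for the order -/

/-- `LeftCut F P R`: the tree `B⁺(P)` is a full subtree of `F` whose root lies on the leftmost
branch of `F`, and `R` is what remains of `F` once this tree is removed. -/
inductive LeftCut : PlanarForest → PlanarForest → PlanarForest → Prop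
  | root (P R : PlanarForest) : LeftCut (.node P :: R) P R
  | above {Q P R : PlanarForest} (S : PlanarForest) (h : LeftCut Q P R) :
      LeftCut (.node Q :: S) P (.node R :: S)

/-- A subtree on the leftmost branch can be moved to the far left of the forest. -/
theorem LeftCut.below_node_cons {F P R : PlanarForest} (h : LeftCut F P R) :
    Below F (.node P :: R) := by
  induction h with
  | root P R => exact Relation.ReflTransGen.refl
  | @above Q P R S _ ih => exact (ih.node S).tail (Transforms.here [] P R S)

/-- A cut pulls back along one transformation. If the transformation happens inside the cut subtree
or away from it, it acts on `P` or on `R` alone. If it detaches a vertex of the leftmost branch, the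
cut is found one level higher before the transformation. -/
theorem LeftCut.of_transforms {F F' P' R' : PlanarForest} (h : LeftCut F' P' R')
    (hF : Transforms F F') : ∃ P R, LeftCut F P R ∧ Below P P' ∧ Below R R' := by
  induction h generalizing F with
  | root P' R' =>
    generalize hE : PlanarTree.node P' :: R' = E at hF
    cases hF with
    | here A S C D =>
      cases A with
      | nil =>
        obtain ⟨⟨rfl⟩, rfl⟩ := List.cons.inj hE
        -- The cut tree is the one just detached. It was the leftmost child of the first root, and
        -- cutting it there leaves the same remainder.
        exact ⟨_, _, .above D (.root _ C), .refl, .refl⟩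
      | cons t A =>
        obtain ⟨rfl, rfl⟩ := List.cons.inj hE
        exact ⟨_, _, .root _ _, .refl, .single (.here A S C D)⟩
    | above A D h =>
      cases A with
      | nil =>
        obtain ⟨⟨rfl⟩, rfl⟩ := List.cons.inj hE
        exact ⟨_, _, .root _ _, .single h, .refl⟩
      | cons t A =>
        obtain ⟨rfl, rfl⟩ := List.cons.inj hE
        exact ⟨_, _, .root _ _, .refl, .single (.above A D h)⟩
  | @above Q P' R' U hQ ih =>
    generalize hE : PlanarTree.node Q :: U = E at hF
    cases hF with
    | here A S C D =>
      cases A with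
      | nil =>
        obtain ⟨⟨rfl⟩, rfl⟩ := List.cons.inj hE
        -- The cut lies strictly inside the detached tree. Before the transformation it sits one
        -- level higher, and the two remainders differ by that same transformation.
        exact ⟨_, _, .above D (.above C hQ), .refl, .single (.here [] R' C D)⟩
      | cons t A =>
        obtain ⟨rfl, rfl⟩ := List.cons.inj hE
        exact ⟨_, _, .above _ hQ, .refl, .single (.here (_ :: A) S C D)⟩
    | above A D h =>
      cases A with
      | nil =>
        obtain ⟨⟨rfl⟩, rfl⟩ := List.cons.inj hE
        obtain ⟨P, R, hc, hP, hR⟩ := ih h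
        exact ⟨P, _, .above _ hc, hP, hR.node _⟩
      | cons t A =>
        obtain ⟨rfl, rfl⟩ := List.cons.inj hE
        exact ⟨_, _, .above _ hQ, .refl, .single (.above (_ :: A) D h)⟩

/-- Pulling the cut at the first root back along the chain of transformations gives one direction.
Conversely, the cut subtree can be brought to the far left, after which both parts are transformed
separately. -/
theorem below_node_cons_iff {E F G : PlanarForest} :
    Below E (.node F :: G) ↔ ∃ P R, LeftCut E P R ∧ Below P F ∧ Below R G := by
  constructor
  · intro h
    induction h using Relation.ReflTransGen.head_induction_on with
    | refl => exact ⟨F, G, .root F G, .refl, .refl⟩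
    | head h _ ih =>
      obtain ⟨P', R', hc, hP, hR⟩ := ih
      obtain ⟨P, R, hc', hP', hR'⟩ := hc.of_transforms h
      exact ⟨P, R, hc', hP'.trans hP, hR'.trans hR⟩
  · rintro ⟨P, R, hc, hP, hR⟩
    exact Relation.ReflTransGen.trans hc.below_node_cons (hP.node_cons hR)

/-! ### Removal of a root -/

/-- The list of the pairs `(A H, L)` for all the factorizations `F = A B⁺(H) L`. -/
def rootRemovals : PlanarForest → List (PlanarForest × PlanarForest)
  | [] => []
  | .node H :: L => (H, L) :: (rootRemovals L).map fun p => (.node H :: p.1, p.2)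

/-- Read `B⁺(F) G` as a binary tree with branches `F` and `G`: `m` exchanges the two branches
everywhere. It thus turns the row of roots into the leftmost branch, and what lies to the right of a
root into what lies above a vertex. -/
theorem leftCut_mirror_iff {F P R : PlanarForest} :
    LeftCut (mirror F) P R ↔ ∃ p ∈ rootRemovals F, P = mirror p.2 ∧ R = mirror p.1 := by
  match F with
  | [] =>
    simp only [mirror, rootRemovals, List.not_mem_nil, false_and, exists_false, iff_false]
    intro h
    cases h
  | .node H :: L =>
    simp only [mirror, rootRemovals, List.mem_cons, List.mem_map, exists_eq_or_imp]
    constructor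
    · intro h
      cases h with
      | root => exact Or.inl ⟨rfl, rfl⟩
      | above S h =>
        obtain ⟨p, hp, rfl, rfl⟩ := leftCut_mirror_iff.1 h
        exact Or.inr ⟨_, ⟨p, hp, rfl⟩, rfl, by simp only [mirror]⟩
    · rintro (⟨rfl, rfl⟩ | ⟨_, ⟨p, hp, rfl⟩, rfl, rfl⟩)
      · exact .root _ _
      · simp only [mirror]
        exact .above _ (leftCut_mirror_iff.2 ⟨p, hp, rfl, rfl⟩)

/-- The order-theoretic counterpart of `pairing_mon_cons`, with the existential in place of the sum.
-/
theorem mirror_below_node_cons_iff {E F G : PlanarForest} :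
    Below (mirror E) (.node F :: G) ↔
      ∃ p ∈ rootRemovals E, Below (mirror p.1) G ∧ Below (mirror p.2) F := by
  rw [below_node_cons_iff]
  constructor
  · rintro ⟨P, R, hc, hP, hR⟩
    obtain ⟨p, hp, rfl, rfl⟩ := leftCut_mirror_iff.1 hc
    exact ⟨p, hp, hR, hP⟩
  · rintro ⟨p, hp, hG, hF⟩
    exact ⟨_, _, leftCut_mirror_iff.2 ⟨p, hp, rfl, rfl⟩, hF, hG⟩

theorem weight_snd_lt_of_mem_rootRemovals {F : PlanarForest} {p : PlanarForest × PlanarForest}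
    (hp : p ∈ rootRemovals F) : weight p.2 < weight F := by
  match F with
  | [] => simp [rootRemovals] at hp
  | .node H :: L =>
    simp only [rootRemovals, List.mem_cons, List.mem_map] at hp
    simp only [weight]
    rcases hp with rfl | ⟨q, hq, rfl⟩
    · dsimp only; omega
    · have := weight_snd_lt_of_mem_rootRemovals hq
      dsimp only; omega

open Classical in
/-- A property that prescribes the weight of the right factor holds for at most one removal of a
root. -/
theorem sum_rootRemovals_ite {R : Type*} [Semiring R] (n : ℕ) :
    ∀ (F : PlanarForest) (P : PlanarForest × PlanarForest → Prop),
      (∀ p, P p → weight p.2 = n) →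
      ((rootRemovals F).map fun p => if P p then (1 : R) else 0).sum
        = if ∃ p ∈ rootRemovals F, P p then 1 else 0
  | [], P, _ => by simp [rootRemovals]
  | .node H :: L, P, hP => by
    have ih := sum_rootRemovals_ite (R := R) n L (fun p => P (.node H :: p.1, p.2))
      (fun p hp => hP (.node H :: p.1, p.2) hp)
    simp only [rootRemovals, List.map_cons, List.sum_cons, List.map_map, Function.comp_def, ih,
      List.mem_cons, List.mem_map, exists_eq_or_imp, exists_exists_and_eq_and]
    by_cases h : P (H, L)
    · have h' : ¬ ∃ p ∈ rootRemovals L, P (.node H :: p.1, p.2) := by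
        rintro ⟨p, hp, hp'⟩
        have h1 := weight_snd_lt_of_mem_rootRemovals hp
        have h2 := hP _ hp'
        have h3 := hP _ h
        dsimp only at h2 h3
        omega
      simp [h, h']
    · simp [h]

/-! ### The pairing of two forests -/

section Field

variable {K : Type*} [Field K]

theorem gamma_graft_mul_mon (F : PlanarForest) (x : ForestAlgebra K) :
    gamma K (graft K x * mon K F) = counit K x • mon K F := by
  induction x using forest_induction with
  | hm G =>
    rw [graft_mon, ← mon_append, gamma_mon]
    match G with
    | [] => simp [gammaForest, counit_mon_nil]
    | t :: G => simp [gammaForest, counit_mon_cons]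
  | ha x y hx hy => simp only [map_add, add_mul, hx, hy, add_smul]
  | hs a x hx => simp only [map_smul, smul_mul_assoc, hx, smul_eq_mul, mul_smul]

/-- In `Δ(B⁺(H) L)`, the part `(B⁺(H) ⊗ 1) Δ(L)` yields the removals of later roots. In the part
coming from `Δ(H)`, `γ(B⁺(x) L) = ε(x) L`, so the counit axiom collapses it to `H ⊗ L`, the removal
of the first root. -/
theorem lTensor_gamma_coproduct_mon (F : PlanarForest) :
    (gamma K).lTensor (ForestAlgebra K) (coproduct K (mon K F))
      = ((rootRemovals F).map fun p => mon K p.1 ⊗ₜ[K] mon K p.2).sum := by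
  match F with
  | [] =>
    have h : gamma K 1 = 0 := by rw [← mon_nil, gamma_mon]; simp [gammaForest]
    simp [mon_nil, coproduct_one, rootRemovals, h]
  | .node H :: L =>
    have e1 : ∀ w : ForestAlgebra K ⊗[K] ForestAlgebra K,
        (gamma K).lTensor (ForestAlgebra K) ((mon K [.node H] ⊗ₜ 1) * w)
          = (mon K [.node H] ⊗ₜ 1) * (gamma K).lTensor (ForestAlgebra K) w := by
      intro w
      induction w with
      | zero => simp
      | tmul a b => simp
      | add u v hu hv => simp only [mul_add, map_add, hu, hv]
    have e2 : ∀ w : ForestAlgebra K ⊗[K] ForestAlgebra K,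
        (gamma K).lTensor (ForestAlgebra K)
            ((graft K).lTensor (ForestAlgebra K) w * (1 ⊗ₜ mon K L))
          = TensorProduct.rid K _ ((counit K).lTensor (ForestAlgebra K) w) ⊗ₜ mon K L := by
      intro w
      induction w with
      | zero => simp
      | tmul a b => simp [gamma_graft_mul_mon, TensorProduct.smul_tmul]
      | add u v hu hv => simp only [map_add, add_mul, hu, hv, TensorProduct.add_tmul]
    have e3 : ∀ l : List (PlanarForest × PlanarForest),
        (mon K [.node H] ⊗ₜ[K] (1 : ForestAlgebra K))
            * (l.map fun p => mon K p.1 ⊗ₜ[K] mon K p.2).sum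
          = (l.map fun p => mon K (.node H :: p.1) ⊗ₜ[K] mon K p.2).sum := by
      intro l
      rw [← List.sum_map_mul_left]
      congr 1
      refine List.map_congr_left fun p _ => ?_
      rw [Algebra.TensorProduct.tmul_mul_tmul, one_mul, ← mon_cons]
    -- The term `B⁺(H) ⊗ L` arising from `Δ(B⁺(H))` cancels the correction term of the infinitesimal
    -- product rule.
    have e4 : coproduct K (mon K (.node H :: L))
        = (mon K [.node H] ⊗ₜ 1) * coproduct K (mon K L)
          + (graft K).lTensor (ForestAlgebra K) (coproduct K (mon K H)) * (1 ⊗ₜ mon K L) := by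
      simp only [coproduct_mon, coproductForest, add_mul, Algebra.TensorProduct.tmul_mul_tmul,
        one_mul, mul_one]
      abel
    rw [e4, map_add, e1, e2, lTensor_gamma_coproduct_mon L, e3, counit_right]
    simp only [rootRemovals, List.map_cons, List.sum_cons, List.map_map, Function.comp_def]
    simp [add_comm]

theorem pairing_mon_cons (F G E : PlanarForest) :
    pairing K (mon K (.node F :: G)) (mon K E)
      = ((rootRemovals E).map fun p =>
          pairing K (mon K G) (mon K p.1) * pairing K (mon K F) (mon K p.2)).sum := by
  have h : ∀ w : ForestAlgebra K ⊗[K] ForestAlgebra K,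
      LinearMap.mul' K K (TensorProduct.map (pairingForest K G) (pairingForest K F ∘ₗ gamma K) w)
        = LinearMap.mul' K K (TensorProduct.map (pairingForest K G) (pairingForest K F)
            ((gamma K).lTensor (ForestAlgebra K) w)) := by
    intro w
    induction w with
    | zero => simp
    | tmul a b => simp
    | add u v hu hv => simp only [map_add, hu, hv]
  rw [pairing_mon, pairingForest, LinearMap.comp_apply, LinearMap.comp_apply, h,
    lTensor_gamma_coproduct_mon, map_list_sum, map_list_sum, List.map_map, List.map_map]
  simp [Function.comp_def, pairing_mon]

open Classical in
/-- The pairing of two forests is `1` or `0`, according to the order. -/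
theorem pairing_mon_mon : ∀ F G : PlanarForest,
    pairing K (mon K F) (mon K G) = if Below (mirror G) F then 1 else 0
  | [], G => by
    rw [mon_nil, pairing_one]
    simp only [below_nil_iff, mirror_eq_nil_iff]
    cases G with
    | nil => simp [counit_mon_nil]
    | cons t G => simp [counit_mon_cons]
  | .node C :: D, G => by
    rw [pairing_mon_cons]
    simp only [pairing_mon_mon C, pairing_mon_mon D, mirror_below_node_cons_iff]
    -- The order preserves weight, so a nonzero term forces the right factor to have the weight of
    -- `C`.
    have h := sum_rootRemovals_ite (R := K) (weight C) G
      (fun p => Below (mirror p.1) D ∧ Below (mirror p.2) C)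
      fun p hp => by rw [hp.2.weight_eq, weight_mirror]
    convert h using 4 with p
    split_ifs <;> simp_all

/-! ### The dual basis -/

variable (K) in
/-- The Möbius combination of the forests below `M`. -/
noncomputable def moebiusSum {n : ℕ} (M : OfWeight n) : ForestAlgebra K :=
  ∑ G : OfWeight n with G ≤ M, IncidenceAlgebra.mu K G M • mon K G.forest

/-- Möbius inversion, by exchanging the sums. It expresses each forest through the Möbius
combinations, which gives spanning. -/
theorem sum_moebiusSum {n : ℕ} (M : OfWeight n) :
    ∑ G : OfWeight n with G ≤ M, moebiusSum K G = mon K M.forest := by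
  simp only [moebiusSum]
  rw [Finset.sum_comm' (t' := Finset.univ) (s' := fun H => Finset.Icc H M)]
  · simp only [← Finset.sum_smul, IncidenceAlgebra.sum_Icc_mu_right, ite_smul, one_smul, zero_smul]
    simp
  · intro G H
    simp [and_comm]

open Classical in
-- Pairing with `G` keeps only the `H` with `m(G) ≤ H ≤ m(F)`, and the sum of `μ(H, m(F))` over this
-- interval is a Kronecker delta.
theorem pairing_moebiusSum_mirror {n : ℕ} (F : OfWeight n) (G : PlanarForest) :
    pairing K (moebiusSum K F.mirror) (mon K G) = if F.forest = G then 1 else 0 := by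
  simp only [moebiusSum, map_sum, map_smul, LinearMap.sum_apply, LinearMap.smul_apply,
    pairing_mon_mon, smul_eq_mul, mul_ite, mul_one, mul_zero]
  by_cases hG : weight G = n
  · let E : OfWeight n := ⟨G, hG⟩
    have h : ∀ H : OfWeight n, Below (mirror G) H.forest ↔ E.mirror ≤ H := fun H => Iff.rfl
    have hE : E.mirror = F.mirror ↔ F.forest = G := by
      constructor
      · intro h
        have h' : mirror G = mirror F.forest := congrArg OfWeight.forest h
        rw [← mirror_mirror G, h', mirror_mirror]
      · intro h
        have : E = F := Subtype.ext h.symm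
        rw [this]
    simp only [h]
    rw [← Finset.sum_filter, Finset.filter_filter]
    have hs : (Finset.univ.filter fun H : OfWeight n => H ≤ F.mirror ∧ E.mirror ≤ H)
        = Finset.Icc E.mirror F.mirror := by
      ext H
      simp [and_comm]
    rw [hs, IncidenceAlgebra.sum_Icc_mu_left]
    simp only [hE]
  -- If the weights differ, no term survives, because comparable forests have equal weight.
  · have hF : F.forest ≠ G := fun h => hG (h ▸ F.2)
    rw [if_neg hF]
    refine Finset.sum_eq_zero fun H _ => if_neg fun h => hG ?_
    rw [← weight_mirror, ← h.weight_eq]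
    exact H.2

variable (K) in
/-- The element of `H` that is dual to the forest `F`. -/
noncomputable def dualForest (F : PlanarForest) : ForestAlgebra K :=
  moebiusSum K (OfWeight.mirror (⟨F, rfl⟩ : OfWeight (weight F)))

theorem dualForest_forest {n : ℕ} (F : OfWeight n) :
    dualForest K F.forest = moebiusSum K F.mirror := by
  obtain ⟨F, rfl⟩ := F
  rfl

open Classical in
theorem pairing_dualForest (F G : PlanarForest) :
    pairing K (dualForest K F) (mon K G) = if F = G then 1 else 0 :=
  pairing_moebiusSum_mirror _ G

/-- Pairing a linear relation with `G` isolates its coefficient at `G`. -/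
theorem linearIndependent_dualForest : LinearIndependent K (dualForest K) := by
  classical
  rw [linearIndependent_iff]
  intro l hl
  ext G
  have h := congrArg (fun x => pairing K x (mon K G)) hl
  simpa [Finsupp.linearCombination_apply, Finsupp.sum, pairing_dualForest] using h

theorem span_dualForest : ⊤ ≤ Submodule.span K (Set.range (dualForest K)) := by
  rw [← (forestBasis K).span_eq, Submodule.span_le]
  rintro _ ⟨F, rfl⟩
  rw [forestBasis_apply]
  have h := sum_moebiusSum (K := K) (⟨F, rfl⟩ : OfWeight (weight F))
  change _ = mon K F at h
  rw [← h]
  -- The Möbius combination attached to `G` is dual to `m(G)`, since `m` is an involution.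
  refine Submodule.sum_mem _ fun G _ => Submodule.subset_span ⟨G.mirror.forest, ?_⟩
  rw [dualForest_forest]
  congr 1
  exact Subtype.ext (mirror_mirror _)

variable (K) in
/-- The dual basis of the basis of forests. -/
noncomputable def dualForestBasis : Module.Basis PlanarForest K (ForestAlgebra K) :=
  Module.Basis.mk linearIndependent_dualForest span_dualForest

theorem dualForestBasis_apply (F : PlanarForest) : dualForestBasis K F = dualForest K F :=
  Module.Basis.mk_apply _ _ F

/-- Pairings with forests are coordinates in the dual basis, so they determine the element. This
gives the uniqueness of `f_F`. -/
theorem pairing_mon_eq_repr (x : ForestAlgebra K) (G : PlanarForest) :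
    pairing K x (mon K G) = (dualForestBasis K).repr x G := by
  classical
  suffices h : (pairing K).flip (mon K G) = (dualForestBasis K).coord G from
    LinearMap.congr_fun h x
  refine (dualForestBasis K).ext fun F => ?_
  rw [LinearMap.flip_apply, dualForestBasis_apply, pairing_dualForest, ← dualForestBasis_apply,
    Module.Basis.coord_apply, Module.Basis.repr_self, Finsupp.single_apply]

end Field

end PlanarForest

theorem corollary39 (K : Type*) [Field K] :
    ∃ f : Module.Basis PlanarForest K (PlanarForest.ForestAlgebra K),
      (∀ (F : PlanarForest) (x : PlanarForest.ForestAlgebra K),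
        (∀ G : PlanarForest, PlanarForest.pairing K x (PlanarForest.mon K G)
          = open Classical in if F = G then 1 else 0) ↔ x = f F) ∧
      ∀ (n : ℕ) (F : PlanarForest.OfWeight n),
        f F.forest = ∑ G : PlanarForest.OfWeight n with G ≤ F.mirror,
          IncidenceAlgebra.mu K G F.mirror • PlanarForest.mon K G.forest := by
  refine ⟨PlanarForest.dualForestBasis K, fun F x => ⟨fun h => ?_, ?_⟩, fun n F => ?_⟩
  · refine (PlanarForest.dualForestBasis K).ext_elem fun G => ?_
    rw [← PlanarForest.pairing_mon_eq_repr, ← PlanarForest.pairing_mon_eq_repr, h,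
      PlanarForest.dualForestBasis_apply, PlanarForest.pairing_dualForest]
  · rintro rfl G
    rw [PlanarForest.dualForestBasis_apply, PlanarForest.pairing_dualForest]
  · rw [PlanarForest.dualForestBasis_apply, PlanarForest.dualForest_forest]
    rfl
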